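/- Let $n\ge 0$ be an integer and let $\beta\in\mathbb R$, $\beta\neq 0$. Write $[\mathtt a,\mathtt b]=\mathtt a\mathtt b-\mathtt b\mathtt a$, $\mathtt g_{\rm sym}=\frac12(\mathtt g+\mathtt g^{T})$, $\mathtt g_{\rm skew}=\frac12(\mathtt g-\mathtt g^{T})$ and $|\mathtt g|_F^2=\operatorname{Tr}\mathtt g\mathtt g^{T}$ for real $n\times n$ matrices. Let $\mathrm{GL}^+(n)$ be the group of real $n\times n$ matrices with positive determinant, an open subset of $\mathbb R^{n\times n}$, so that all its tangent spaces are $\mathbb R^{n\times n}$. Consider the bilinear form $\langle \mathtt g,\mathtt h\rangle=\operatorname{Tr}(\mathtt h\mathtt g)-(1+\beta)\operatorname{Tr}(\mathtt h_{\rm skew}\mathtt g_{\rm skew})$ on $\mathbb R^{n\times n}$, for which $$\langle \mathtt g,\mathtt g\rangle=\operatorname{Tr}\mathtt g^2-(\beta+1)\operatorname{Tr}\mathtt g_{\rm skew}^2=\operatorname{Tr}\mathtt g_{\rm sym}^2+\beta\operatorname{Tr}\mathtt g_{\rm skew}^{T}\mathtt g_{\rm skew}=|\mathtt g|_F^2+(\beta-1)|\mathtt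 g_{\rm skew}|_F^2 .$$ Then $\langle\xi,\eta\rangle_X=\langle X^{-1}\xi,X^{-1}\eta\rangle$ is a (left-invariant) pseudo-Riemannian metric on $\mathrm{GL}^+(n)$, and the following hold. 1. The Levi-Civita connection of this metric exists, is unique, and is given on smooth vector fields by $\nabla_{\mathtt Y}\mathtt Z=\mathrm D_{\mathtt Y}\mathtt Z+\Gamma(\mathtt Y,\mathtt Z)$, where $\mathrm D_{\mathtt Y}\mathtt Z$ is the directional derivative of $\mathtt Z$ as a matrix-valued function and, for $\xi,\eta$ tangent at $X$, $$\Gamma(\xi,\eta)=-\tfrac12(\xi X^{-1}\eta+\eta X^{-1}\xi)+\tfrac{1+\beta}{4}X\left([X^{-1}\xi,(X^{-1}\eta)^{T}]+[X^{-1}\eta,(X^{-1}\xi)^{T}]\right).$$ 2. Let $X\in\mathrm{GL}^+(n)$, let $\xi$ be a tangent vector at $X$, and put $\mathtt a=X^{-1}\xi$. The geodesic with $\gamma(0)=X$, $\dot\gamma(0)=\xi$ is defined for all $t\in\mathbb R$ and is $$\gamma(t)=X\exp\!\left(\tfrac t2\left((1-\beta)\mathtt a+(1+\beta)\mathtt a^{T}\right)\right)\exp\!\left(t(1+\beta)\mathtt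 a_{\rm skew}\right);$$ every geodesic with these initial values, on any interval containing $0$, is a restriction of it. 3. The parallel transport along $\gamma$ from $0$ to $t$ of a tangent vector $\eta$ at $X$ is $$\mathtt T_0^t(\gamma)\eta=X\exp\!\left(\tfrac t2\left((1-\beta)\mathtt a+(1+\beta)\mathtt a^{T}\right)\right)\,\bigl(\exp(t\mathrm P_{\mathtt a})(X^{-1}\eta)\bigr)\,\exp\!\left(t(1+\beta)\mathtt a_{\rm skew}\right),$$ where $\exp(t\mathrm P_{\mathtt a})$ is the exponential of the linear operator $t\mathrm P_{\mathtt a}$ on $\mathbb R^{n\times n}$ and $$\mathrm P_{\mathtt a}\mathtt b=\tfrac12\left([\mathtt b,\mathtt a]+(1+\beta)([\mathtt a_{\rm skew},\mathtt b]-[\mathtt b_{\rm skew},\mathtt a])\right).$$ That is, the right-hand side, as a function of $t\in\mathbb R$, is a parallel vector field over $\gamma$ with value $\eta$ at $t=0$, and every parallel vector field over $\gamma$ with this value at $0$, on any interval containing $0$, is a restriction of it. -/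

import Mathlib

open scoped ContDiff Matrix Matrix.Norms.Operator

/-! ### Connections, geodesics and parallel transport on an open subset of a vector space

All tangent spaces of an open set `U ⊆ E` are identified with `E`. A vector field on `U` is a map
`E → E`, of which only the restriction to `U` matters. -/

section Geometry

variable {E : Type*} [NormedAddCommGroup E] [NormedSpace ℝ E]

/-- `g` is a pseudo-Riemannian metric on `U`: a smooth family of nondegenerate symmetric bilinear
forms `g X`, `X ∈ U`. -/
structure IsPseudoRiemannianMetricOn (U : Set E) (g : E → LinearMap.BilinForm ℝ E) : Prop where
  symm : ∀ X ∈ U, ∀ v w : E, g X v w = g X w v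
  nondegenerate : ∀ X ∈ U, ∀ v : E, (∀ w : E, g X v w = 0) → v = 0
  smooth : ∀ v w : E, ContDiffOn ℝ ∞ (fun X => g X v w) U

/-- `nabla Y Z`, read as `∇_Y Z`, is an affine connection on the smooth vector fields of `U`. -/
structure IsConnectionOn (U : Set E) (nabla : (E → E) → (E → E) → E → E) : Prop where
  smooth : ∀ Y Z : E → E, ContDiffOn ℝ ∞ Y U → ContDiffOn ℝ ∞ Z U →
    ContDiffOn ℝ ∞ (nabla Y Z) U
  add_left : ∀ Y₁ Y₂ Z : E → E, ContDiffOn ℝ ∞ Y₁ U → ContDiffOn ℝ ∞ Y₂ U →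
    ContDiffOn ℝ ∞ Z U → ∀ X ∈ U, nabla (Y₁ + Y₂) Z X = nabla Y₁ Z X + nabla Y₂ Z X
  smul_left : ∀ (f : E → ℝ) (Y Z : E → E), ContDiffOn ℝ ∞ f U → ContDiffOn ℝ ∞ Y U →
    ContDiffOn ℝ ∞ Z U → ∀ X ∈ U, nabla (fun x => f x • Y x) Z X = f X • nabla Y Z X
  add_right : ∀ Y Z₁ Z₂ : E → E, ContDiffOn ℝ ∞ Y U → ContDiffOn ℝ ∞ Z₁ U →
    ContDiffOn ℝ ∞ Z₂ U → ∀ X ∈ U, nabla Y (Z₁ + Z₂) X = nabla Y Z₁ X + nabla Y Z₂ X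
  leibniz : ∀ (f : E → ℝ) (Y Z : E → E), ContDiffOn ℝ ∞ f U → ContDiffOn ℝ ∞ Y U →
    ContDiffOn ℝ ∞ Z U → ∀ X ∈ U,
      nabla Y (fun x => f x • Z x) X = f X • nabla Y Z X + fderiv ℝ f X (Y X) • Z X

/-- `nabla` is a Levi-Civita connection of the metric `g` on `U`: an affine connection that is
torsion-free and compatible with `g`. -/
structure IsLeviCivitaOn (U : Set E) (g : E → LinearMap.BilinForm ℝ E)
    (nabla : (E → E) → (E → E) → E → E) : Prop where
  isConnectionOn : IsConnectionOn U nabla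
  torsion_free : ∀ Y Z : E → E, ContDiffOn ℝ ∞ Y U → ContDiffOn ℝ ∞ Z U → ∀ X ∈ U,
    nabla Y Z X - nabla Z Y X = VectorField.lieBracket ℝ Y Z X
  metric_compatible : ∀ Y Z W : E → E, ContDiffOn ℝ ∞ Y U → ContDiffOn ℝ ∞ Z U →
    ContDiffOn ℝ ∞ W U → ∀ X ∈ U,
      fderiv ℝ (fun x => g x (Z x) (W x)) X (Y X)
        = g X (nabla Y Z X) (W X) + g X (Z X) (nabla Y W X)

/-- `∇_Y Z = D_Y Z + Γ(Y, Z)` on `U`, that is, `Γ` is the Christoffel function of `nabla`. -/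
def HasChristoffelFunctionOn (U : Set E) (nabla : (E → E) → (E → E) → E → E)
    (Γ : E → E → E → E) : Prop :=
  ∀ Y Z : E → E, ContDiffOn ℝ ∞ Y U → ContDiffOn ℝ ∞ Z U → ∀ X ∈ U,
    nabla Y Z X = fderiv ℝ Z X (Y X) + Γ X (Y X) (Z X)

/-- The Christoffel function of a connection, read off on constant vector fields. -/
def christoffel (nabla : (E → E) → (E → E) → E → E) (X ξ η : E) : E :=
  nabla (fun _ => ξ) (fun _ => η) X

/-- The covariant derivative `V̇ + Γ(c; ċ, V)` of a vector field `V` over the curve `c`, where the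
time runs in the interval `J`. -/
noncomputable def covDerivAlong (nabla : (E → E) → (E → E) → E → E) (J : Set ℝ) (c V : ℝ → E)
    (t : ℝ) : E :=
  derivWithin V J t + christoffel nabla (c t) (derivWithin c J t) (V t)

/-- `c` is a geodesic in `U` over the time interval `J`: `∇_ċ ċ = 0`. -/
structure IsGeodesicOn (U : Set E) (nabla : (E → E) → (E → E) → E → E) (J : Set ℝ)
    (c : ℝ → E) : Prop where
  mapsTo : Set.MapsTo c J U
  differentiableOn : DifferentiableOn ℝ c J
  differentiableOn_velocity : DifferentiableOn ℝ (derivWithin c J) J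
  equation : ∀ t ∈ J, covDerivAlong nabla J c (derivWithin c J) t = 0

/-- The vector field `V` over the curve `c` is parallel over the time interval `J`. -/
structure IsParallelOn (nabla : (E → E) → (E → E) → E → E) (J : Set ℝ) (c V : ℝ → E) :
    Prop where
  differentiableOn : DifferentiableOn ℝ V J
  equation : ∀ t ∈ J, covDerivAlong nabla J c V t = 0

/-- The exponential action `expa(A, v) = exp(A) v` of a linear operator on a
finite-dimensional space. -/
noncomputable def expAction [FiniteDimensional ℝ E] (A : E →ₗ[ℝ] E) (v : E) : E :=
  NormedSpace.exp (LinearMap.toContinuousLinearMap A) v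

end Geometry

/-! ### The group `GL⁺(n)` with its left-invariant metric -/

section GLPlus

variable {n : ℕ}

/-- The (open) set of real `n × n` matrices of positive determinant. -/
def GLPlus (n : ℕ) : Set (Matrix (Fin n) (Fin n) ℝ) := {X | 0 < X.det}

/-- The symmetric part of a matrix. -/
noncomputable def symPart (A : Matrix (Fin n) (Fin n) ℝ) : Matrix (Fin n) (Fin n) ℝ :=
  (1 / 2 : ℝ) • (A + Aᵀ)

/-- The antisymmetric part of a matrix: its projection to the antisymmetric matrices `𝔰𝔬(n)`. -/
noncomputable def skewPart (A : Matrix (Fin n) (Fin n) ℝ) : Matrix (Fin n) (Fin n) ℝ :=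
  (1 / 2 : ℝ) • (A - Aᵀ)

theorem skewPart_add (A B : Matrix (Fin n) (Fin n) ℝ) :
    skewPart (A + B) = skewPart A + skewPart B := by
  simp only [skewPart, Matrix.transpose_add]
  module

theorem skewPart_smul (c : ℝ) (A : Matrix (Fin n) (Fin n) ℝ) :
    skewPart (c • A) = c • skewPart A := by
  simp only [skewPart, Matrix.transpose_smul]
  module

/-- The squared Frobenius norm. -/
def frobSq (A : Matrix (Fin n) (Fin n) ℝ) : ℝ := (A * Aᵀ).trace

/-- The form `⟨g, h⟩ = Tr (h g) - Tr (h_skew g_skew) - β Tr (h_skew g_skew)` on `𝔤𝔩(n)`. -/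
noncomputable def glForm (n : ℕ) (β : ℝ) :
    LinearMap.BilinForm ℝ (Matrix (Fin n) (Fin n) ℝ) :=
  LinearMap.mk₂ ℝ
    (fun g h => ((h * g).trace - (skewPart h * skewPart g).trace)
      - β * (skewPart h * skewPart g).trace)
    (by intro a b c; simp only [skewPart_add, mul_add, Matrix.trace_add]; ring)
    (by intro r a b
        simp only [skewPart_smul, Matrix.mul_smul, Matrix.trace_smul, smul_eq_mul]; ring)
    (by intro a b c; simp only [skewPart_add, add_mul, mul_add, Matrix.trace_add]; ring)
    (by intro r a b
        simp only [skewPart_smul, Matrix.smul_mul, Matrix.trace_smul, smul_eq_mul]; ring)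

/-- The left-invariant metric `⟨ξ, η⟩_X = ⟨X⁻¹ ξ, X⁻¹ η⟩`. -/
noncomputable def glMetric (n : ℕ) (β : ℝ) (X : Matrix (Fin n) (Fin n) ℝ) :
    LinearMap.BilinForm ℝ (Matrix (Fin n) (Fin n) ℝ) :=
  (glForm n β).compl₁₂ (LinearMap.mulLeft ℝ X⁻¹) (LinearMap.mulLeft ℝ X⁻¹)

/-- The function `Γ(X; ξ, η) = -½ (ξ X⁻¹ η + η X⁻¹ ξ)
+ (1 + β)/4 X ([X⁻¹ ξ, (X⁻¹ η)ᵀ] + [X⁻¹ η, (X⁻¹ ξ)ᵀ])`. -/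
noncomputable def glChristoffel (β : ℝ) (X ξ η : Matrix (Fin n) (Fin n) ℝ) :
    Matrix (Fin n) (Fin n) ℝ :=
  -((1 / 2 : ℝ) • (ξ * X⁻¹ * η + η * X⁻¹ * ξ))
    + ((1 + β) / 4) • (X * (⁅X⁻¹ * ξ, (X⁻¹ * η)ᵀ⁆ + ⁅X⁻¹ * η, (X⁻¹ * ξ)ᵀ⁆))

/-- The operator `P_a b = ½ ([b, a] + (1 + β) ([a_skew, b] - [b_skew, a]))`. -/
noncomputable def glTransportOp (β : ℝ) (a : Matrix (Fin n) (Fin n) ℝ) :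
    Matrix (Fin n) (Fin n) ℝ →ₗ[ℝ] Matrix (Fin n) (Fin n) ℝ where
  toFun b := (1 / 2 : ℝ) • (⁅b, a⁆ + (1 + β) • (⁅skewPart a, b⁆ - ⁅skewPart b, a⁆))
  map_add' b c := by
    simp only [skewPart_add, Ring.lie_def, add_mul, mul_add]
    module
  map_smul' r b := by
    simp only [skewPart_smul, Ring.lie_def, Matrix.smul_mul, Matrix.mul_smul, RingHom.id_apply]
    module

/-- The curve `X exp(t/2 ((1 - β) a + (1 + β) aᵀ)) exp(t (1 + β) a_skew)` with `a = X⁻¹ ξ`. -/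
noncomputable def glGeodesic (β : ℝ) (X ξ : Matrix (Fin n) (Fin n) ℝ) (t : ℝ) :
    Matrix (Fin n) (Fin n) ℝ :=
  X * NormedSpace.exp ((t / 2) • ((1 - β) • (X⁻¹ * ξ) + (1 + β) • (X⁻¹ * ξ)ᵀ))
    * NormedSpace.exp ((t * (1 + β)) • skewPart (X⁻¹ * ξ))

/-- The curve `X exp(t/2 ((1 - β) a + (1 + β) aᵀ)) expa(t P_a, X⁻¹ η) exp(t (1 + β) a_skew)` with
`a = X⁻¹ ξ`. -/
noncomputable def glTransport (β : ℝ) (X ξ η : Matrix (Fin n) (Fin n) ℝ) (t : ℝ) :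
    Matrix (Fin n) (Fin n) ℝ :=
  X * NormedSpace.exp ((t / 2) • ((1 - β) • (X⁻¹ * ξ) + (1 + β) • (X⁻¹ * ξ)ᵀ))
    * expAction (t • glTransportOp β (X⁻¹ * ξ)) (X⁻¹ * η)
    * NormedSpace.exp ((t * (1 + β)) • skewPart (X⁻¹ * ξ))

end GLPlus

/-! Everything is computed in the left trivialisation, where the metric is the constant form
`glForm`. There the candidate connection on left-invariant fields is `½[a,z] + (1+β)/4 ([a,zᵀ] +
[z,aᵀ])`, which is antisymmetric for the form (`glForm_connection_antisymm`). This gives metric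
compatibility, and symmetry of `glChristoffel` gives vanishing torsion. Since `β ≠ 0` makes the form
nondegenerate, the explicit connection is the only one.

Write `a = X⁻¹ξ`, `K = (1+β) a_skew` and `S = a - K`; these are `glRightGenerator` and
`glLeftGenerator`. For a geodesic `c`, the body velocity `u = c⁻¹ċ` satisfies `u' = -(1+β)/2
[u,uᵀ]`. The bracket is symmetric, so `u_skew` is conserved; the bracket also equals `2[u_skew,u]`,
so the equation becomes the linear `u' = [u,K]`, and `u = exp(-tK) a exp(tK)`. Then `c exp(-tK)`
solves `f' = f S`, whence `c = X exp(tS) exp(tK)`.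

For transport, `K` is skew, so `exp(tK)` is a rotation and the metric is invariant under it on the
right. In the frame `F_t b = X exp(tS) b exp(tK)` the covariant derivative therefore has constant
coefficients: it sends `F_t b` to `F_t (b' - P_a b)` (`covDerivAlong_glGeodesic`). Parallel fields
are solutions of `b' = P_a b`, and the velocity is the constant solution `b = a`. -/

/-! ### Uniqueness of the Levi-Civita connection. -/

section LeviCivitaUniqueness

variable {E : Type*} [NormedAddCommGroup E] [NormedSpace ℝ E]

/-- Two Levi-Civita connections of the same pseudo-Riemannian metric agree. -/
theorem IsLeviCivitaOn.unique {U : Set E} {g : E → LinearMap.BilinForm ℝ E}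
    {nabla nabla' : (E → E) → (E → E) → E → E} (hg : IsPseudoRiemannianMetricOn U g)
    (h : IsLeviCivitaOn U g nabla) (h' : IsLeviCivitaOn U g nabla') {Y Z : E → E}
    (hY : ContDiffOn ℝ ∞ Y U) (hZ : ContDiffOn ℝ ∞ Z U) {X : E} (hX : X ∈ U) :
    nabla Y Z X = nabla' Y Z X := by
  have hs : ∀ Y Z : E → E, ContDiffOn ℝ ∞ Y U → ContDiffOn ℝ ∞ Z U →
      nabla Y Z X - nabla' Y Z X = nabla Z Y X - nabla' Z Y X := by
    intro Y Z hY hZ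
    have := (h.torsion_free Y Z hY hZ X hX).trans (h'.torsion_free Y Z hY hZ X hX).symm
    rw [sub_eq_sub_iff_add_eq_add] at this ⊢
    rw [this, add_comm]
  have ha : ∀ Y Z W : E → E, ContDiffOn ℝ ∞ Y U → ContDiffOn ℝ ∞ Z U → ContDiffOn ℝ ∞ W U →
      g X (nabla Y Z X - nabla' Y Z X) (W X) = -g X (nabla Y W X - nabla' Y W X) (Z X) := by
    intro Y Z W hY hZ hW
    have := (h.metric_compatible Y Z W hY hZ hW X hX).symm.trans
      (h'.metric_compatible Y Z W hY hZ hW X hX)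
    rw [hg.symm X hX (Z X), hg.symm X hX (Z X)] at this
    simp only [map_sub, LinearMap.sub_apply]
    linarith
  -- The trilinear expression `g(∇_Y Z - ∇'_Y Z, W)` is symmetric in `Y, Z` and antisymmetric in `Z,
  -- W`. Permuting the three fields cyclically shows that it equals its own negative.
  refine sub_eq_zero.1 (hg.nondegenerate X hX _ fun w => ?_)
  have hW : ContDiffOn ℝ ∞ (fun _ : E => w) U := contDiffOn_const
  have h1 := ha Y Z _ hY hZ hW
  have h2 := ha _ Y Z hW hY hZ
  have h3 := ha Z _ Y hZ hW hY
  rw [hs Y _ hY hW] at h1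
  rw [hs _ Z hW hZ] at h2
  rw [hs Z Y hZ hY] at h3
  linarith

end LeviCivitaUniqueness

/-! ### Algebra of the form and of the Christoffel function. -/

section Algebra

variable {n : ℕ} {β : ℝ}

theorem glForm_apply (g h : Matrix (Fin n) (Fin n) ℝ) :
    glForm n β g h = ((h * g).trace - (skewPart h * skewPart g).trace)
      - β * (skewPart h * skewPart g).trace := rfl

theorem glMetric_apply (X g h : Matrix (Fin n) (Fin n) ℝ) :
    glMetric n β X g h = glForm n β (X⁻¹ * g) (X⁻¹ * h) := rfl

theorem glForm_comm (g h : Matrix (Fin n) (Fin n) ℝ) : glForm n β g h = glForm n β h g := by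
  rw [glForm_apply, glForm_apply, Matrix.trace_mul_comm h, Matrix.trace_mul_comm (skewPart h)]

/-- The form is the trace pairing with the operator `g ↦ g_sym - β g_skew`, since transposition
moves the skew projection from `h` onto `g`. -/
theorem glForm_eq_trace (g h : Matrix (Fin n) (Fin n) ℝ) :
    glForm n β g h = (h * (g - (1 + β) • skewPart g)).trace := by
  have h1 : (hᵀ * g).trace = (h * gᵀ).trace := by
    rw [← Matrix.trace_transpose, Matrix.transpose_mul, Matrix.transpose_transpose,
      Matrix.trace_mul_comm]
  have h2 : (hᵀ * gᵀ).trace = (h * g).trace := by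
    rw [← Matrix.trace_transpose, Matrix.transpose_mul, Matrix.transpose_transpose,
      Matrix.transpose_transpose, Matrix.trace_mul_comm]
  simp only [glForm_apply, skewPart, mul_sub, sub_mul, Matrix.smul_mul, Matrix.mul_smul,
    Matrix.trace_sub, Matrix.trace_smul, smul_eq_mul, h1, h2]
  ring

theorem glForm_self_trace (g : Matrix (Fin n) (Fin n) ℝ) :
    glForm n β g g = (g * g).trace - (β + 1) * (skewPart g * skewPart g).trace := by
  rw [glForm_apply]; ring

theorem trace_transpose_mul_transpose (g : Matrix (Fin n) (Fin n) ℝ) :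
    (gᵀ * gᵀ).trace = (g * g).trace := by
  rw [← Matrix.transpose_mul, Matrix.trace_transpose]

theorem glForm_self_symPart (g : Matrix (Fin n) (Fin n) ℝ) :
    glForm n β g g = (symPart g * symPart g).trace
      + β * ((skewPart g)ᵀ * skewPart g).trace := by
  simp only [glForm_apply, skewPart, symPart, mul_add, mul_sub, add_mul, sub_mul, Matrix.smul_mul,
    Matrix.mul_smul, Matrix.trace_add, Matrix.trace_sub, Matrix.trace_smul, smul_eq_mul,
    Matrix.transpose_smul, Matrix.transpose_sub, Matrix.transpose_transpose,
    trace_transpose_mul_transpose, Matrix.trace_mul_comm gᵀ g]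
  ring

theorem glForm_self_frobSq (g : Matrix (Fin n) (Fin n) ℝ) :
    glForm n β g g = frobSq g + (β - 1) * frobSq (skewPart g) := by
  simp only [glForm_apply, skewPart, frobSq, mul_sub, sub_mul, Matrix.smul_mul,
    Matrix.mul_smul, Matrix.trace_sub, Matrix.trace_smul, smul_eq_mul,
    Matrix.transpose_smul, Matrix.transpose_sub, Matrix.transpose_transpose,
    trace_transpose_mul_transpose, Matrix.trace_mul_comm gᵀ g]
  ring

theorem skewPart_transpose (g : Matrix (Fin n) (Fin n) ℝ) : (skewPart g)ᵀ = -skewPart g := by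
  simp only [skewPart, Matrix.transpose_smul, Matrix.transpose_sub, Matrix.transpose_transpose]
  module

theorem glForm_nondegenerate (hβ : β ≠ 0) {g : Matrix (Fin n) (Fin n) ℝ}
    (hg : ∀ h, glForm n β g h = 0) : g = 0 := by
  have h1 : g - (1 + β) • skewPart g = 0 := by
    -- With this test matrix the form becomes a squared Frobenius norm. The skew part of the
    -- resulting equation is `-β g_skew = 0`, where `β ≠ 0` enters.
    have := hg (g - (1 + β) • skewPart g)ᵀ
    rw [glForm_eq_trace, ← Matrix.conjTranspose_eq_transpose_of_trivial] at this
    exact Matrix.trace_conjTranspose_mul_self_eq_zero_iff.1 this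
  have h2 : skewPart g = 0 := by
    have h3 := congrArg skewPart h1
    have h4 : skewPart (skewPart g) = skewPart g := by
      rw [skewPart, skewPart_transpose]; module
    rw [sub_eq_add_neg, ← neg_smul, skewPart_add, skewPart_smul, h4] at h3
    have h5 : (-β) • skewPart g = 0 := by
      rw [show skewPart (0 : Matrix (Fin n) (Fin n) ℝ) = 0 by simp [skewPart]] at h3
      rw [← h3]; module
    exact (smul_eq_zero.1 h5).resolve_left (neg_ne_zero.2 hβ)
  simpa [h2] using h1

/-- The Levi-Civita connection on left-invariant fields takes values in the operators that are
antisymmetric with respect to the form. -/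
theorem glForm_connection_antisymm (a z w : Matrix (Fin n) (Fin n) ℝ) :
    glForm n β ((1 / 2 : ℝ) • (a * z - z * a) + ((1 + β) / 4) • (⁅a, zᵀ⁆ + ⁅z, aᵀ⁆)) w
      + glForm n β z ((1 / 2 : ℝ) • (a * w - w * a) + ((1 + β) / 4) • (⁅a, wᵀ⁆ + ⁅w, aᵀ⁆))
      = 0 := by
  -- Cyclicity and transposition bring every trace to the form `Tr (a ⋯)` with no `aᵀ`; the identity
  -- is then linear in the remaining traces.
  have c1 : ∀ x y : Matrix (Fin n) (Fin n) ℝ, (x * (a * y)).trace = (a * (y * x)).trace :=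
    fun x y => by rw [Matrix.trace_mul_comm, mul_assoc]
  have c2 : ∀ x y : Matrix (Fin n) (Fin n) ℝ, (x * (y * a)).trace = (a * (x * y)).trace :=
    fun x y => by rw [← mul_assoc, Matrix.trace_mul_comm]
  have t : ∀ x : Matrix (Fin n) (Fin n) ℝ, (aᵀ * x).trace = (a * xᵀ).trace := fun x => by
    rw [← Matrix.trace_transpose, Matrix.transpose_mul, Matrix.transpose_transpose,
      Matrix.trace_mul_comm]
  have d1 : ∀ x y : Matrix (Fin n) (Fin n) ℝ, (x * (aᵀ * y)).trace = (aᵀ * (y * x)).trace :=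
    fun x y => by rw [Matrix.trace_mul_comm, mul_assoc]
  have d2 : ∀ x y : Matrix (Fin n) (Fin n) ℝ, (x * (y * aᵀ)).trace = (aᵀ * (x * y)).trace :=
    fun x y => by rw [← mul_assoc, Matrix.trace_mul_comm]
  rw [glForm_eq_trace, glForm_comm z, glForm_eq_trace]
  simp only [skewPart, Ring.lie_def, Matrix.transpose_add, Matrix.transpose_sub,
    Matrix.transpose_smul, Matrix.transpose_mul, Matrix.transpose_transpose,
    mul_add, mul_sub, add_mul, smul_add, smul_sub, Matrix.mul_smul, Matrix.trace_add, Matrix.trace_sub,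
    Matrix.trace_smul, smul_eq_mul, c1, c2, d1, d2, t]
  ring

theorem glChristoffel_comm (X ξ η : Matrix (Fin n) (Fin n) ℝ) :
    glChristoffel β X ξ η = glChristoffel β X η ξ := by
  rw [glChristoffel, glChristoffel, add_comm (ξ * X⁻¹ * η), add_comm ⁅X⁻¹ * ξ, _⁆]

theorem glChristoffel_add (X ξ η ζ : Matrix (Fin n) (Fin n) ℝ) :
    glChristoffel β X ξ (η + ζ) = glChristoffel β X ξ η + glChristoffel β X ξ ζ := by
  simp only [glChristoffel, mul_add, add_mul, Matrix.transpose_add, Ring.lie_def, mul_sub]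
  module

theorem glChristoffel_smul (r : ℝ) (X ξ η : Matrix (Fin n) (Fin n) ℝ) :
    glChristoffel β X ξ (r • η) = r • glChristoffel β X ξ η := by
  simp only [glChristoffel, mul_add, mul_sub, Matrix.mul_smul, Matrix.smul_mul,
    Matrix.transpose_smul, Ring.lie_def]
  module

/-- The Christoffel function in a left-invariant frame. -/
theorem glChristoffel_mul {X : Matrix (Fin n) (Fin n) ℝ} (hX : IsUnit X.det)
    (a b : Matrix (Fin n) (Fin n) ℝ) :
    glChristoffel β X (X * a) (X * b)
      = X * (-((1 / 2 : ℝ) • (a * b + b * a)) + ((1 + β) / 4) • (⁅a, bᵀ⁆ + ⁅b, aᵀ⁆)) := by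
  simp only [glChristoffel, Matrix.nonsing_inv_mul_cancel_left _ _ hX, mul_assoc, mul_add, mul_neg,
    Matrix.mul_smul]

end Algebra

/-! ### Smoothness and product rule for a constant bilinear form. -/

section BilinForm

variable {E F : Type*} [NormedAddCommGroup E] [NormedSpace ℝ E] [NormedAddCommGroup F]
  [NormedSpace ℝ F] [FiniteDimensional ℝ F]

theorem LinearMap.BilinForm.contDiffOn_comp (b : LinearMap.BilinForm ℝ F) {U : Set E}
    {p q : E → F} (hp : ContDiffOn ℝ ∞ p U) (hq : ContDiffOn ℝ ∞ q U) :
    ContDiffOn ℝ ∞ (fun x => b (p x) (q x)) U :=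
  ((b.toContinuousBilinearMap.contDiff).comp_contDiffOn hp).clm_apply hq

theorem LinearMap.BilinForm.fderiv_comp (b : LinearMap.BilinForm ℝ F) {X : E}
    {p q : E → F} (hp : DifferentiableAt ℝ p X) (hq : DifferentiableAt ℝ q X) (v : E) :
    fderiv ℝ (fun x => b (p x) (q x)) X v
      = b (fderiv ℝ p X v) (q X) + b (p X) (fderiv ℝ q X v) := by
  have h := b.toContinuousBilinearMap.hasFDerivAt_of_bilinear hp.hasFDerivAt hq.hasFDerivAt
  refine (congrArg (fun L => L v) h.fderiv).trans ?_
  simp [add_comm]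

end BilinForm

/-! ### Existence and characterisation of the Levi-Civita connection. -/

section LeviCivita

variable {n : ℕ} {β : ℝ}

theorem isOpen_GLPlus : IsOpen (GLPlus n) :=
  isOpen_lt continuous_const (Continuous.matrix_det continuous_id)

theorem isUnit_det_of_mem_GLPlus {X : Matrix (Fin n) (Fin n) ℝ} (hX : X ∈ GLPlus n) :
    IsUnit X.det :=
  isUnit_iff_ne_zero.2 (ne_of_gt hX)

theorem contDiffOn_inv_GLPlus :
    ContDiffOn ℝ ∞ (fun X : Matrix (Fin n) (Fin n) ℝ => X⁻¹) (GLPlus n) := by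
  intro X hX
  simp only [Matrix.nonsing_inv_eq_ringInverse]
  obtain ⟨u, rfl⟩ := (Matrix.isUnit_iff_isUnit_det X).2 (isUnit_det_of_mem_GLPlus hX)
  exact (contDiffAt_ringInverse ℝ u).contDiffWithinAt

theorem hasFDerivAt_inv_mul {X : Matrix (Fin n) (Fin n) ℝ} (hX : X ∈ GLPlus n)
    {Z : Matrix (Fin n) (Fin n) ℝ → Matrix (Fin n) (Fin n) ℝ} (hZ : DifferentiableAt ℝ Z X) :
    DifferentiableAt ℝ (fun x => x⁻¹ * Z x) X ∧ ∀ v, fderiv ℝ (fun x => x⁻¹ * Z x) X v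
      = X⁻¹ * fderiv ℝ Z X v - X⁻¹ * v * (X⁻¹ * Z X) := by
  obtain ⟨u, rfl⟩ := (Matrix.isUnit_iff_isUnit_det X).2 (isUnit_det_of_mem_GLPlus hX)
  have h := (hasFDerivAt_ringInverse (𝕜 := ℝ) u).mul' hZ.hasFDerivAt
  simp only [← Matrix.nonsing_inv_eq_ringInverse] at h
  simp only [Matrix.nonsing_inv_eq_ringInverse]
  refine ⟨h.differentiableAt, fun v => ?_⟩
  refine (congrArg (fun L => L v) h.fderiv).trans ?_
  simp [mul_assoc, sub_eq_add_neg, Matrix.coe_units_inv]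
  rfl

theorem contDiffOn_transpose {U : Set (Matrix (Fin n) (Fin n) ℝ)}
    {f : Matrix (Fin n) (Fin n) ℝ → Matrix (Fin n) (Fin n) ℝ} (hf : ContDiffOn ℝ ∞ f U) :
    ContDiffOn ℝ ∞ (fun X => (f X)ᵀ) U :=
  (LinearMap.toContinuousLinearMap
    (Matrix.transposeLinearEquiv (Fin n) (Fin n) ℝ ℝ).toLinearMap).contDiff.comp_contDiffOn hf

theorem contDiffOn_glChristoffel {Y Z : Matrix (Fin n) (Fin n) ℝ → Matrix (Fin n) (Fin n) ℝ}
    (hY : ContDiffOn ℝ ∞ Y (GLPlus n)) (hZ : ContDiffOn ℝ ∞ Z (GLPlus n)) :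
    ContDiffOn ℝ ∞ (fun X => glChristoffel β X (Y X) (Z X)) (GLPlus n) := by
  have hi := contDiffOn_inv_GLPlus (n := n)
  have hy := hi.mul hY
  have hz := hi.mul hZ
  have hyt := contDiffOn_transpose hy
  have hzt := contDiffOn_transpose hz
  simp only [glChristoffel, Ring.lie_def]
  exact (((((hY.mul hi).mul hZ).add ((hZ.mul hi).mul hY)).const_smul _).neg).add
    ((contDiffOn_id.mul (((hy.mul hzt).sub (hzt.mul hy)).add
      ((hz.mul hyt).sub (hyt.mul hz)))).const_smul _)

theorem glMetric_nondegenerate (hβ : β ≠ 0) {X : Matrix (Fin n) (Fin n) ℝ} (hX : X ∈ GLPlus n)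
    {v : Matrix (Fin n) (Fin n) ℝ} (h : ∀ w, glMetric n β X v w = 0) : v = 0 := by
  have hu := isUnit_det_of_mem_GLPlus hX
  have h0 : X⁻¹ * v = 0 := glForm_nondegenerate hβ fun w => by
    have := h (X * w)
    rwa [glMetric_apply, Matrix.nonsing_inv_mul_cancel_left _ _ hu] at this
  rw [← Matrix.mul_nonsing_inv_cancel_left _ v hu, h0, mul_zero]

theorem glMetric_comm (X v w : Matrix (Fin n) (Fin n) ℝ) :
    glMetric n β X v w = glMetric n β X w v := by
  rw [glMetric_apply, glMetric_apply, glForm_comm]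

theorem contDiffOn_glForm {f g : Matrix (Fin n) (Fin n) ℝ → Matrix (Fin n) (Fin n) ℝ}
    {U : Set (Matrix (Fin n) (Fin n) ℝ)} (hf : ContDiffOn ℝ ∞ f U) (hg : ContDiffOn ℝ ∞ g U) :
    ContDiffOn ℝ ∞ (fun X => glForm n β (f X) (g X)) U :=
  (glForm n β).contDiffOn_comp hf hg

theorem contDiffOn_glMetric (v w : Matrix (Fin n) (Fin n) ℝ) :
    ContDiffOn ℝ ∞ (fun X => glMetric n β X v w) (GLPlus n) := by
  have hi := contDiffOn_inv_GLPlus (n := n)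
  simp only [glMetric_apply]
  exact contDiffOn_glForm (f := fun X => X⁻¹ * v) (g := fun X => X⁻¹ * w)
    (hi.mul contDiffOn_const) (hi.mul contDiffOn_const)

theorem isPseudoRiemannianMetricOn_glMetric (hβ : β ≠ 0) :
    IsPseudoRiemannianMetricOn (GLPlus n) (glMetric n β) :=
  ⟨fun X _ => glMetric_comm X, fun _ hX _ h => glMetric_nondegenerate hβ hX h,
    contDiffOn_glMetric⟩

/-- Metric compatibility. Differentiating `X⁻¹Z` produces an extra `-X⁻¹v X⁻¹Z`, and `X⁻¹Γ(v, Z)` is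
that same term plus an operator antisymmetric for the form, whose two contributions cancel. -/
theorem fderiv_glMetric {X : Matrix (Fin n) (Fin n) ℝ} (hX : X ∈ GLPlus n)
    {Z W : Matrix (Fin n) (Fin n) ℝ → Matrix (Fin n) (Fin n) ℝ} (hZ : DifferentiableAt ℝ Z X)
    (hW : DifferentiableAt ℝ W X) (v : Matrix (Fin n) (Fin n) ℝ) :
    fderiv ℝ (fun x => glMetric n β x (Z x) (W x)) X v
      = glMetric n β X (fderiv ℝ Z X v + glChristoffel β X v (Z X)) (W X)
        + glMetric n β X (Z X) (fderiv ℝ W X v + glChristoffel β X v (W X)) := by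
  have hu := isUnit_det_of_mem_GLPlus hX
  obtain ⟨dZ, hZ'⟩ := hasFDerivAt_inv_mul hX hZ
  obtain ⟨dW, hW'⟩ := hasFDerivAt_inv_mul hX hW
  have hΓ : ∀ y, X⁻¹ * glChristoffel β X v y
      = (1 / 2 : ℝ) • (X⁻¹ * v * (X⁻¹ * y) - X⁻¹ * y * (X⁻¹ * v))
        + ((1 + β) / 4) • (⁅X⁻¹ * v, (X⁻¹ * y)ᵀ⁆ + ⁅X⁻¹ * y, (X⁻¹ * v)ᵀ⁆)
        - X⁻¹ * v * (X⁻¹ * y) := fun y => by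
    have := glChristoffel_mul (β := β) hu (X⁻¹ * v) (X⁻¹ * y)
    rw [Matrix.mul_nonsing_inv_cancel_left _ v hu, Matrix.mul_nonsing_inv_cancel_left _ y hu]
      at this
    rw [this, Matrix.nonsing_inv_mul_cancel_left _ _ hu]
    module
  have key := glForm_connection_antisymm (β := β) (X⁻¹ * v) (X⁻¹ * Z X) (X⁻¹ * W X)
  simp only [glMetric_apply, mul_add, hΓ]
  refine ((glForm n β).fderiv_comp dZ dW v).trans ?_
  refine (congrArg₂ (fun y z => glForm n β y (X⁻¹ * W X) + glForm n β (X⁻¹ * Z X) z)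
    (hZ' v) (hW' v)).trans ?_
  simp only [map_add, map_sub, LinearMap.add_apply, LinearMap.sub_apply] at key ⊢
  linarith

theorem isLeviCivitaOn_of_hasChristoffelFunctionOn
    {nabla : (Matrix (Fin n) (Fin n) ℝ → Matrix (Fin n) (Fin n) ℝ) →
      (Matrix (Fin n) (Fin n) ℝ → Matrix (Fin n) (Fin n) ℝ) →
      Matrix (Fin n) (Fin n) ℝ → Matrix (Fin n) (Fin n) ℝ}
    (h : HasChristoffelFunctionOn (GLPlus n) nabla (glChristoffel β)) :
    IsLeviCivitaOn (GLPlus n) (glMetric n β) nabla := by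
  have hd : ∀ {F : Type} [NormedAddCommGroup F] [NormedSpace ℝ F]
      {f : Matrix (Fin n) (Fin n) ℝ → F}, ContDiffOn ℝ ∞ f (GLPlus n) →
      ∀ {X}, X ∈ GLPlus n → DifferentiableAt ℝ f X := fun hf X hX =>
    (hf.contDiffAt (isOpen_GLPlus.mem_nhds hX)).differentiableAt (by simp)
  have hl : ∀ X ξ η ζ : Matrix (Fin n) (Fin n) ℝ, glChristoffel β X (ξ + η) ζ
      = glChristoffel β X ξ ζ + glChristoffel β X η ζ := fun X ξ η ζ => by
    rw [glChristoffel_comm, glChristoffel_add, glChristoffel_comm, glChristoffel_comm X ζ η]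
  have hl' : ∀ (r : ℝ) (X ξ η : Matrix (Fin n) (Fin n) ℝ), glChristoffel β X (r • ξ) η
      = r • glChristoffel β X ξ η := fun r X ξ η => by
    rw [glChristoffel_comm, glChristoffel_smul, glChristoffel_comm]
  refine ⟨⟨?_, ?_, ?_, ?_, ?_⟩, ?_, ?_⟩
  · intro Y Z hY hZ
    exact (((hZ.fderiv_of_isOpen isOpen_GLPlus (by simp)).clm_apply hY).add
      (contDiffOn_glChristoffel hY hZ)).congr fun X hX => h Y Z hY hZ X hX
  · intro Y₁ Y₂ Z hY₁ hY₂ hZ X hX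
    rw [h (Y₁ + Y₂) _ (hY₁.add hY₂) hZ X hX, h _ _ hY₁ hZ X hX, h _ _ hY₂ hZ X hX, Pi.add_apply, map_add,
      hl]
    abel
  · intro f Y Z hf hY hZ X hX
    rw [h (fun x => f x • Y x) _ (hf.smul hY) hZ X hX, h _ _ hY hZ X hX, map_smul, hl', smul_add]
  · intro Y Z₁ Z₂ hY hZ₁ hZ₂ X hX
    rw [h _ (Z₁ + Z₂) hY (hZ₁.add hZ₂) X hX, h _ _ hY hZ₁ X hX, h _ _ hY hZ₂ X hX, Pi.add_apply,
      glChristoffel_add, fderiv_add (hd hZ₁ hX) (hd hZ₂ hX), add_apply]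
    abel
  · intro f Y Z hf hY hZ X hX
    rw [h _ (fun x => f x • Z x) hY (hf.smul hZ) X hX, h _ _ hY hZ X hX, glChristoffel_smul,
      fderiv_fun_smul (hd hf hX) (hd hZ hX)]
    simp only [add_apply, smul_apply,
      ContinuousLinearMap.smulRight_apply, smul_add]
    abel
  · intro Y Z hY hZ X hX
    rw [h _ _ hY hZ X hX, h _ _ hZ hY X hX, glChristoffel_comm, VectorField.lieBracket]
    abel
  · intro Y Z W hY hZ hW X hX
    rw [h _ _ hY hZ X hX, h _ _ hY hW X hX]
    exact fderiv_glMetric hX (hd hZ hX) (hd hW hX) _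

/-- The explicit formula itself defines a Levi-Civita connection, so uniqueness forces any other one
to agree with it. -/
theorem isLeviCivitaOn_iff_hasChristoffelFunctionOn (hβ : β ≠ 0)
    (nabla : (Matrix (Fin n) (Fin n) ℝ → Matrix (Fin n) (Fin n) ℝ) →
      (Matrix (Fin n) (Fin n) ℝ → Matrix (Fin n) (Fin n) ℝ) →
      Matrix (Fin n) (Fin n) ℝ → Matrix (Fin n) (Fin n) ℝ) :
    IsLeviCivitaOn (GLPlus n) (glMetric n β) nabla ↔
      HasChristoffelFunctionOn (GLPlus n) nabla (glChristoffel β) := by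
  refine ⟨fun h Y Z hY hZ X hX => ?_, isLeviCivitaOn_of_hasChristoffelFunctionOn⟩
  refine h.unique (isPseudoRiemannianMetricOn_glMetric hβ)
    (nabla' := fun Y Z X => fderiv ℝ Z X (Y X) + glChristoffel β X (Y X) (Z X)) ?_ hY hZ hX
  exact isLeviCivitaOn_of_hasChristoffelFunctionOn fun _ _ _ _ _ _ => rfl

theorem HasChristoffelFunctionOn.christoffel_eq
    {E : Type*} [NormedAddCommGroup E] [NormedSpace ℝ E] {U : Set E}
    {nabla : (E → E) → (E → E) → E → E} {Γ : E → E → E → E}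
    (h : HasChristoffelFunctionOn U nabla Γ) {X : E} (hX : X ∈ U) (ξ η : E) :
    christoffel nabla X ξ η = Γ X ξ η := by
  rw [christoffel, h _ _ contDiffOn_const contDiffOn_const X hX]
  simp

end LeviCivita

/-! ### Linear differential equations with constant coefficients on an interval. -/

section LinearODE

variable {E F : Type*} [NormedAddCommGroup E] [NormedSpace ℝ E] [NormedAddCommGroup F]
  [NormedSpace ℝ F] {𝔸 : Type*} [NormedRing 𝔸] [NormedAlgebra ℝ 𝔸] [CompleteSpace 𝔸]
  {J : Set ℝ}

/-- The mean value inequality with constant `0`. It is the only uniqueness principle for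
differential equations needed here, and it holds on any interval, degenerate ones included. -/
theorem Set.OrdConnected.eq_of_hasDerivWithinAt_zero (hJ : J.OrdConnected) {f : ℝ → E}
    (hf : ∀ t ∈ J, HasDerivWithinAt f 0 J t) {s t : ℝ} (hs : s ∈ J) (ht : t ∈ J) :
    f s = f t := by
  have := hJ.convex.norm_image_sub_le_of_norm_hasDerivWithin_le (C := 0) hf (by simp) ht hs
  simpa [sub_eq_zero] using this

theorem HasDerivWithinAt.linearMap_comp [FiniteDimensional ℝ E] (L : E →ₗ[ℝ] F) {f : ℝ → E}
    {f' : E} {t : ℝ} (hf : HasDerivWithinAt f f' J t) :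
    HasDerivWithinAt (fun s => L (f s)) (L f') J t :=
  (LinearMap.toContinuousLinearMap L).hasFDerivAt.comp_hasDerivWithinAt t hf

theorem exp_smul_mul_exp_neg_smul (A : 𝔸) (t : ℝ) :
    NormedSpace.exp (t • A) * NormedSpace.exp (t • -A) = 1 := by
  rw [smul_neg, ← NormedSpace.exp_add_of_commute_of_mem_ball (𝕂 := ℝ)
    (Commute.neg_right (Commute.refl _))] <;> simp [NormedSpace.expSeries_radius_eq_top]

theorem exp_neg_smul_mul_exp_smul (A : 𝔸) (t : ℝ) :
    NormedSpace.exp (t • -A) * NormedSpace.exp (t • A) = 1 := by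
  simpa using exp_smul_mul_exp_neg_smul (-A) t

/-- The derivative of `exp (tA) f(t) exp (tB)`. -/
theorem HasDerivWithinAt.exp_smul_mul_mul_exp_smul (A B : 𝔸) {f : ℝ → 𝔸} {f' : 𝔸} {t : ℝ}
    (hf : HasDerivWithinAt f f' J t) :
    HasDerivWithinAt
      (fun s : ℝ => NormedSpace.exp (s • A) * f s * NormedSpace.exp (s • B))
      (NormedSpace.exp (t • A) * (A * f t + f' + f t * B) * NormedSpace.exp (t • B)) J t := by
  -- The two forms of the derivative of the exponential are chosen so that `A` and `B` land next to
  -- `f`, inside both exponentials.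
  have hA := (hasDerivAt_exp_smul_const (𝕂 := ℝ) A t).hasDerivWithinAt (s := J)
  have hB := (hasDerivAt_exp_smul_const' (𝕂 := ℝ) B t).hasDerivWithinAt (s := J)
  refine ((hA.mul hf).mul hB).congr_deriv ?_
  simp only [Pi.mul_apply]
  noncomm_ring

theorem HasDerivWithinAt.ringInverse {c : ℝ → 𝔸} {c' : 𝔸} {t : ℝ}
    (hc : HasDerivWithinAt c c' J t) (hu : IsUnit (c t)) :
    HasDerivWithinAt (fun s => Ring.inverse (c s))
      (-(Ring.inverse (c t) * c' * Ring.inverse (c t))) J t := by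
  obtain ⟨u, hu⟩ := hu
  have h := hasFDerivAt_ringInverse (𝕜 := ℝ) u
  rw [hu] at h
  refine (h.comp_hasDerivWithinAt t hc).congr_deriv ?_
  simp [← hu]

/-- Solutions of `f' = A f + f B` are conjugate to a constant. -/
theorem eq_exp_smul_mul_mul_exp_smul (hJ : J.OrdConnected) (h0 : (0 : ℝ) ∈ J) (A B : 𝔸)
    {f : ℝ → 𝔸} (hf : ∀ t ∈ J, HasDerivWithinAt f (A * f t + f t * B) J t) {t : ℝ}
    (ht : t ∈ J) :
    f t = NormedSpace.exp (t • A) * f 0 * NormedSpace.exp (t • B) := by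
  -- Integrating factors on both sides: `exp(-sA) f(s) exp(-sB)` has derivative zero.
  have h := hJ.eq_of_hasDerivWithinAt_zero
    (f := fun s => NormedSpace.exp (s • -A) * f s * NormedSpace.exp (s • -B))
    (fun s hs => ((hf s hs).exp_smul_mul_mul_exp_smul (-A) (-B)).congr_deriv
      (by simp only [show -A * f s + (A * f s + f s * B) + f s * -B = 0 by noncomm_ring, mul_zero,
            zero_mul])) ht h0
  simp only [zero_smul, NormedSpace.exp_zero, one_mul, mul_one] at h
  rw [← h]
  simp only [← mul_assoc, exp_smul_mul_exp_neg_smul, one_mul]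
  rw [mul_assoc, exp_neg_smul_mul_exp_smul, mul_one]

theorem hasDerivAt_expAction [FiniteDimensional ℝ E] (A : E →ₗ[ℝ] E) (v : E) (t : ℝ) :
    HasDerivAt (fun s : ℝ => expAction (s • A) v) (A (expAction (t • A) v)) t := by
  have : CompleteSpace E := FiniteDimensional.complete ℝ E
  have h := (hasDerivAt_exp_smul_const' (𝕂 := ℝ) (LinearMap.toContinuousLinearMap A) t).clm_apply
    (hasDerivAt_const t v)
  simp only [expAction, map_smul]
  exact h.congr_deriv (by simp)

theorem expAction_zero_smul [FiniteDimensional ℝ E] (A : E →ₗ[ℝ] E) (v : E) :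
    expAction ((0 : ℝ) • A) v = v := by
  simp [expAction]

/-- Solutions of the linear equation `f' = A f` are given by the exponential. -/
theorem eq_expAction [FiniteDimensional ℝ E] (hJ : J.OrdConnected) (h0 : (0 : ℝ) ∈ J)
    (A : E →ₗ[ℝ] E) {f : ℝ → E} (hf : ∀ t ∈ J, HasDerivWithinAt f (A (f t)) J t) {t : ℝ}
    (ht : t ∈ J) : f t = expAction (t • A) (f 0) := by
  have : CompleteSpace E := FiniteDimensional.complete ℝ E
  set L := LinearMap.toContinuousLinearMap A with hL
  have h := hJ.eq_of_hasDerivWithinAt_zero (f := fun s => NormedSpace.exp (s • -L) (f s))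
    (fun s hs => (((hasDerivAt_exp_smul_const (𝕂 := ℝ) (-L) s).hasDerivWithinAt).clm_apply
      (hf s hs)).congr_deriv (by simp [hL])) ht h0
  simp only [zero_smul, NormedSpace.exp_zero, one_apply_eq_self] at h
  have h2 := congrArg (fun M => M (f t)) (exp_smul_mul_exp_neg_smul L t)
  simp only [mul_apply_eq_comp, one_apply_eq_self, h] at h2
  rw [expAction, map_smul, ← hL, h2]

end LinearODE

/-! ### The moving frame over a geodesic. -/

section MovingFrame

variable {n : ℕ} {β : ℝ}

/-- The matrix `½ ((1 - β) a + (1 + β) aᵀ)`. -/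
noncomputable def glLeftGenerator (β : ℝ) (a : Matrix (Fin n) (Fin n) ℝ) :
    Matrix (Fin n) (Fin n) ℝ :=
  (1 / 2 : ℝ) • ((1 - β) • a + (1 + β) • aᵀ)

/-- The antisymmetric matrix `(1 + β) a_skew`. -/
noncomputable def glRightGenerator (β : ℝ) (a : Matrix (Fin n) (Fin n) ℝ) :
    Matrix (Fin n) (Fin n) ℝ :=
  (1 + β) • skewPart a

/-- The Christoffel function at the identity. -/
noncomputable def glChristoffelOne (β : ℝ) (a b : Matrix (Fin n) (Fin n) ℝ) :
    Matrix (Fin n) (Fin n) ℝ :=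
  -((1 / 2 : ℝ) • (a * b + b * a)) + ((1 + β) / 4) • (⁅a, bᵀ⁆ + ⁅b, aᵀ⁆)

/-- The frame `b ↦ X exp(t/2 ((1 - β) a + (1 + β) aᵀ)) b exp(t (1 + β) a_skew)` over the geodesic
with initial velocity `X a`. -/
noncomputable def glFrame (β : ℝ) (X a : Matrix (Fin n) (Fin n) ℝ) (t : ℝ)
    (b : Matrix (Fin n) (Fin n) ℝ) : Matrix (Fin n) (Fin n) ℝ :=
  X * (NormedSpace.exp (t • glLeftGenerator β a) * b
    * NormedSpace.exp (t • glRightGenerator β a))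

theorem glLeftGenerator_add_glRightGenerator (a : Matrix (Fin n) (Fin n) ℝ) :
    glLeftGenerator β a + glRightGenerator β a = a := by
  simp only [glLeftGenerator, glRightGenerator, skewPart]
  module

theorem glRightGenerator_transpose (a : Matrix (Fin n) (Fin n) ℝ) :
    (glRightGenerator β a)ᵀ = -glRightGenerator β a := by
  rw [glRightGenerator, Matrix.transpose_smul, skewPart_transpose, smul_neg]

/-- The origin of `P_a`: differentiating the frame contributes `S b + b K`, the connection
contributes the Christoffel term, and `-P_a b` is their sum. -/
theorem glTransportOp_apply_eq (a b : Matrix (Fin n) (Fin n) ℝ) :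
    glTransportOp β a b
      = -(glLeftGenerator β a * b + b * glRightGenerator β a + glChristoffelOne β a b) := by
  change (1 / 2 : ℝ) • (⁅b, a⁆ + (1 + β) • (⁅skewPart a, b⁆ - ⁅skewPart b, a⁆)) = _
  simp only [glLeftGenerator, glRightGenerator, glChristoffelOne, skewPart, Ring.lie_def,
    mul_sub, add_mul, sub_mul, Matrix.smul_mul, Matrix.mul_smul]
  module

theorem glTransportOp_self (a : Matrix (Fin n) (Fin n) ℝ) : glTransportOp β a a = 0 := by
  change (1 / 2 : ℝ) • (⁅a, a⁆ + (1 + β) • (⁅skewPart a, a⁆ - ⁅skewPart a, a⁆)) = _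
  simp [Ring.lie_def]

theorem glFrame_zero (X a b : Matrix (Fin n) (Fin n) ℝ) : glFrame β X a 0 b = X * b := by
  simp [glFrame]

theorem glGeodesic_eq_glFrame (X ξ : Matrix (Fin n) (Fin n) ℝ) (t : ℝ) :
    glGeodesic β X ξ t = glFrame β X (X⁻¹ * ξ) t 1 := by
  rw [glGeodesic, glFrame, glLeftGenerator, glRightGenerator, smul_smul, smul_smul, mul_one,
    mul_assoc, mul_one_div]

theorem glTransport_eq_glFrame (X ξ η : Matrix (Fin n) (Fin n) ℝ) (t : ℝ) :
    glTransport β X ξ η t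
      = glFrame β X (X⁻¹ * ξ) t (expAction (t • glTransportOp β (X⁻¹ * ξ)) (X⁻¹ * η)) := by
  rw [glTransport, glFrame, glLeftGenerator, glRightGenerator, smul_smul, smul_smul,
    mul_assoc X, mul_assoc X, mul_one_div]

theorem matrix_exp_smul_mul_exp_neg_smul (A : Matrix (Fin n) (Fin n) ℝ) (t : ℝ) :
    NormedSpace.exp (t • A) * NormedSpace.exp (t • -A) = 1 :=
  exp_smul_mul_exp_neg_smul A t

theorem matrix_exp_neg_smul_mul_exp_smul (A : Matrix (Fin n) (Fin n) ℝ) (t : ℝ) :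
    NormedSpace.exp (t • -A) * NormedSpace.exp (t • A) = 1 :=
  exp_neg_smul_mul_exp_smul A t

theorem exp_mem_GLPlus (A : Matrix (Fin n) (Fin n) ℝ) : NormedSpace.exp A ∈ GLPlus n := by
  -- An exponential is the square of an invertible matrix, so its determinant is positive.
  have h : NormedSpace.exp A = NormedSpace.exp ((1 / 2 : ℝ) • A)
      * NormedSpace.exp ((1 / 2 : ℝ) • A) := by
    rw [← Matrix.exp_add_of_commute _ _ (Commute.refl _), ← add_smul]
    norm_num
  have hu : IsUnit (NormedSpace.exp ((1 / 2 : ℝ) • A)).det :=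
    (Matrix.isUnit_iff_isUnit_det _).1 (Matrix.isUnit_exp _)
  change 0 < (NormedSpace.exp A).det
  rw [h, Matrix.det_mul]
  exact mul_self_pos.2 hu.ne_zero

theorem mul_mem_GLPlus {A B : Matrix (Fin n) (Fin n) ℝ} (hA : A ∈ GLPlus n)
    (hB : B ∈ GLPlus n) : A * B ∈ GLPlus n := by
  change 0 < (A * B).det
  rw [Matrix.det_mul]
  exact mul_pos hA hB

theorem glGeodesic_mem_GLPlus {X : Matrix (Fin n) (Fin n) ℝ} (hX : X ∈ GLPlus n)
    (ξ : Matrix (Fin n) (Fin n) ℝ) (t : ℝ) : glGeodesic β X ξ t ∈ GLPlus n :=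
  mul_mem_GLPlus (mul_mem_GLPlus hX (exp_mem_GLPlus _)) (exp_mem_GLPlus _)

theorem exp_glRightGenerator_transpose (a : Matrix (Fin n) (Fin n) ℝ) (t : ℝ) :
    (NormedSpace.exp (t • glRightGenerator β a))ᵀ
      = NormedSpace.exp (t • -glRightGenerator β a) := by
  rw [← Matrix.exp_transpose, Matrix.transpose_smul, glRightGenerator_transpose]

/-- The Christoffel function is left-invariant, and right-invariant under rotations. -/
theorem glChristoffel_mul_mul {Y Q : Matrix (Fin n) (Fin n) ℝ} (hY : IsUnit Y.det)
    (hQ : Q * Qᵀ = 1) (a b : Matrix (Fin n) (Fin n) ℝ) :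
    glChristoffel β (Y * Q) (Y * a * Q) (Y * b * Q) = Y * glChristoffelOne β a b * Q := by
  have hQ' : Qᵀ * Q = 1 := mul_eq_one_comm.1 hQ
  have hu : IsUnit (Y * Q).det := by
    rw [Matrix.det_mul]
    exact hY.mul ((Matrix.isUnit_iff_isUnit_det Q).1 ⟨⟨Q, Qᵀ, hQ, hQ'⟩, rfl⟩)
  -- In the left trivialisation at `Y * Q`, right multiplication by `Q` becomes conjugation by an
  -- orthogonal matrix, which respects products and transposes.
  have hc : ∀ x : Matrix (Fin n) (Fin n) ℝ, Y * x * Q = Y * Q * (Qᵀ * x * Q) := fun x => by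
    simp only [mul_assoc]
    rw [← mul_assoc Q, hQ, one_mul]
  have hm : ∀ x y : Matrix (Fin n) (Fin n) ℝ, Qᵀ * (x * (y * Q))
      = Qᵀ * (x * (Q * (Qᵀ * (y * Q)))) := fun x y => by
    rw [← mul_assoc Q, hQ, one_mul]
  rw [hc a, hc b, hc (glChristoffelOne β a b), glChristoffel_mul hu]
  simp only [glChristoffelOne, Ring.lie_def, Matrix.transpose_mul, Matrix.transpose_transpose,
    mul_add, add_mul, mul_sub, sub_mul, mul_neg, neg_mul, Matrix.smul_mul, Matrix.mul_smul,
    mul_assoc, hm]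

theorem hasDerivWithinAt_glFrame (X a : Matrix (Fin n) (Fin n) ℝ) {J : Set ℝ}
    {b : ℝ → Matrix (Fin n) (Fin n) ℝ} {b' : Matrix (Fin n) (Fin n) ℝ} {t : ℝ}
    (hb : HasDerivWithinAt b b' J t) :
    HasDerivWithinAt (fun s => glFrame β X a s (b s))
      (glFrame β X a t (glLeftGenerator β a * b t + b' + b t * glRightGenerator β a)) J t :=
  (hb.exp_smul_mul_mul_exp_smul (glLeftGenerator β a) (glRightGenerator β a)).const_mul X

theorem hasDerivWithinAt_glGeodesic (X ξ : Matrix (Fin n) (Fin n) ℝ) (J : Set ℝ) (t : ℝ) :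
    HasDerivWithinAt (glGeodesic β X ξ) (glFrame β X (X⁻¹ * ξ) t (X⁻¹ * ξ)) J t := by
  have h := hasDerivWithinAt_glFrame (β := β) X (X⁻¹ * ξ) (hasDerivWithinAt_const t J 1)
  simp only [mul_one, one_mul, add_zero, glLeftGenerator_add_glRightGenerator] at h
  rw [show glGeodesic β X ξ = _ from funext (glGeodesic_eq_glFrame X ξ)]
  exact h

/-- `glChristoffel_mul_mul` applies with `Y = X exp(tS)` and `Q = exp(tK)`, orthogonal because `K`
is skew. This is why the coefficients in the frame do not depend on `t`. -/
theorem glChristoffel_glFrame {X : Matrix (Fin n) (Fin n) ℝ} (hX : X ∈ GLPlus n)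
    (ξ b : Matrix (Fin n) (Fin n) ℝ) (t : ℝ) :
    glChristoffel β (glGeodesic β X ξ t) (glFrame β X (X⁻¹ * ξ) t (X⁻¹ * ξ))
        (glFrame β X (X⁻¹ * ξ) t b)
      = glFrame β X (X⁻¹ * ξ) t (glChristoffelOne β (X⁻¹ * ξ) b) := by
  have hY : IsUnit (X * NormedSpace.exp (t • glLeftGenerator β (X⁻¹ * ξ))).det :=
    isUnit_det_of_mem_GLPlus (mul_mem_GLPlus hX (exp_mem_GLPlus _))
  have hQ : NormedSpace.exp (t • glRightGenerator β (X⁻¹ * ξ))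
      * (NormedSpace.exp (t • glRightGenerator β (X⁻¹ * ξ)))ᵀ = 1 := by
    rw [exp_glRightGenerator_transpose, matrix_exp_smul_mul_exp_neg_smul]
  have h := glChristoffel_mul_mul (β := β) hY hQ (X⁻¹ * ξ) b
  rw [glGeodesic_eq_glFrame]
  simp only [glFrame, mul_assoc, one_mul] at h ⊢
  exact h

theorem glFrame_add (X a b c : Matrix (Fin n) (Fin n) ℝ) (t : ℝ) :
    glFrame β X a t b + glFrame β X a t c = glFrame β X a t (b + c) := by
  simp only [glFrame, mul_add, add_mul]

/-- The inverse of the frame `glFrame`. -/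
noncomputable def glCoframe (β : ℝ) (X a : Matrix (Fin n) (Fin n) ℝ) (t : ℝ)
    (v : Matrix (Fin n) (Fin n) ℝ) : Matrix (Fin n) (Fin n) ℝ :=
  NormedSpace.exp (t • -glLeftGenerator β a) * (X⁻¹ * v)
    * NormedSpace.exp (t • -glRightGenerator β a)

theorem glFrame_glCoframe {X : Matrix (Fin n) (Fin n) ℝ} (hX : X ∈ GLPlus n)
    (a v : Matrix (Fin n) (Fin n) ℝ) (t : ℝ) : glFrame β X a t (glCoframe β X a t v) = v := by
  simp only [glFrame, glCoframe, ← mul_assoc]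
  simp only [mul_assoc, matrix_exp_neg_smul_mul_exp_smul, mul_one]
  rw [← mul_assoc (NormedSpace.exp _), matrix_exp_smul_mul_exp_neg_smul, one_mul,
    Matrix.mul_nonsing_inv_cancel_left _ _ (isUnit_det_of_mem_GLPlus hX)]

theorem glCoframe_glFrame {X : Matrix (Fin n) (Fin n) ℝ} (hX : X ∈ GLPlus n)
    (a v : Matrix (Fin n) (Fin n) ℝ) (t : ℝ) : glCoframe β X a t (glFrame β X a t v) = v := by
  simp only [glFrame, glCoframe,
    Matrix.nonsing_inv_mul_cancel_left _ _ (isUnit_det_of_mem_GLPlus hX)]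
  simp only [mul_assoc, matrix_exp_smul_mul_exp_neg_smul, mul_one]
  rw [← mul_assoc, matrix_exp_neg_smul_mul_exp_smul, one_mul]

end MovingFrame

/-! ### Geodesics and parallel transport. -/

section GeodesicsAndTransport

variable {n : ℕ} {β : ℝ}
  {nabla : (Matrix (Fin n) (Fin n) ℝ → Matrix (Fin n) (Fin n) ℝ) →
    (Matrix (Fin n) (Fin n) ℝ → Matrix (Fin n) (Fin n) ℝ) →
    Matrix (Fin n) (Fin n) ℝ → Matrix (Fin n) (Fin n) ℝ}

/-- The covariant derivative along `glGeodesic` in the moving frame. -/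
theorem covDerivAlong_glGeodesic
    (h : HasChristoffelFunctionOn (GLPlus n) nabla (glChristoffel β))
    {X : Matrix (Fin n) (Fin n) ℝ} (hX : X ∈ GLPlus n) (ξ : Matrix (Fin n) (Fin n) ℝ) {J : Set ℝ}
    {t : ℝ} (hJ : UniqueDiffWithinAt ℝ J t) {V b : ℝ → Matrix (Fin n) (Fin n) ℝ}
    {b' : Matrix (Fin n) (Fin n) ℝ} (hV : ∀ s, V s = glFrame β X (X⁻¹ * ξ) s (b s))
    (hb : HasDerivWithinAt b b' J t) :
    covDerivAlong nabla J (glGeodesic β X ξ) V t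
      = glFrame β X (X⁻¹ * ξ) t (b' - glTransportOp β (X⁻¹ * ξ) (b t)) := by
  obtain rfl : V = fun s => glFrame β X (X⁻¹ * ξ) s (b s) := funext hV
  have h1 := (hasDerivWithinAt_glFrame (β := β) X (X⁻¹ * ξ) hb).derivWithin hJ
  have h2 := (hasDerivWithinAt_glGeodesic (β := β) X ξ J t).derivWithin hJ
  have h3 := h.christoffel_eq (glGeodesic_mem_GLPlus (β := β) hX ξ t)
    (glFrame β X (X⁻¹ * ξ) t (X⁻¹ * ξ)) (glFrame β X (X⁻¹ * ξ) t (b t))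
  rw [glChristoffel_glFrame hX] at h3
  refine (congrArg₂ (fun y z => y + christoffel nabla (glGeodesic β X ξ t) z
    (glFrame β X (X⁻¹ * ξ) t (b t))) h1 h2).trans ?_
  simp only [h3]
  rw [glFrame_add, glTransportOp_apply_eq]
  congr 1
  abel

theorem isGeodesicOn_glGeodesic
    (h : HasChristoffelFunctionOn (GLPlus n) nabla (glChristoffel β))
    {X : Matrix (Fin n) (Fin n) ℝ} (hX : X ∈ GLPlus n) (ξ : Matrix (Fin n) (Fin n) ℝ) :
    IsGeodesicOn (GLPlus n) nabla Set.univ (glGeodesic β X ξ) := by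
  have hv : derivWithin (glGeodesic β X ξ) Set.univ
      = fun t => glFrame β X (X⁻¹ * ξ) t (X⁻¹ * ξ) := funext fun t =>
    (hasDerivWithinAt_glGeodesic X ξ Set.univ t).derivWithin uniqueDiffWithinAt_univ
  have hd : DifferentiableOn ℝ (derivWithin (glGeodesic β X ξ) Set.univ) Set.univ := by
    rw [hv]
    exact fun t _ => (hasDerivWithinAt_glFrame X (X⁻¹ * ξ)
      (hasDerivWithinAt_const t Set.univ (X⁻¹ * ξ))).differentiableWithinAt
  refine ⟨fun t _ => glGeodesic_mem_GLPlus hX ξ t,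
    fun t _ => (hasDerivWithinAt_glGeodesic X ξ Set.univ t).differentiableWithinAt, hd,
    fun t _ => ?_⟩
  -- The velocity has the constant coordinate `a` in the frame, and `P_a a = 0`.
  refine (covDerivAlong_glGeodesic h hX ξ uniqueDiffWithinAt_univ (fun s => congrFun hv s)
    (hasDerivWithinAt_const t Set.univ (X⁻¹ * ξ))).trans ?_
  simp [glTransportOp_self, glFrame]

theorem glGeodesic_zero {X : Matrix (Fin n) (Fin n) ℝ} (ξ : Matrix (Fin n) (Fin n) ℝ) :
    glGeodesic β X ξ 0 = X := by
  rw [glGeodesic_eq_glFrame, glFrame_zero, mul_one]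

theorem deriv_glGeodesic_zero {X : Matrix (Fin n) (Fin n) ℝ} (hX : X ∈ GLPlus n)
    (ξ : Matrix (Fin n) (Fin n) ℝ) : deriv (glGeodesic β X ξ) 0 = ξ := by
  have h := (hasDerivWithinAt_glGeodesic (β := β) X ξ Set.univ 0).hasDerivAt Filter.univ_mem
  refine h.deriv.trans ?_
  rw [glFrame_zero, Matrix.mul_nonsing_inv_cancel_left _ _ (isUnit_det_of_mem_GLPlus hX)]

theorem isParallelOn_glTransport
    (h : HasChristoffelFunctionOn (GLPlus n) nabla (glChristoffel β))
    {X : Matrix (Fin n) (Fin n) ℝ} (hX : X ∈ GLPlus n) (ξ η : Matrix (Fin n) (Fin n) ℝ) :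
    IsParallelOn nabla Set.univ (glGeodesic β X ξ) (glTransport β X ξ η) := by
  have hb : ∀ t, HasDerivWithinAt
      (fun s : ℝ => expAction (s • glTransportOp β (X⁻¹ * ξ)) (X⁻¹ * η))
      (glTransportOp β (X⁻¹ * ξ) (expAction (t • glTransportOp β (X⁻¹ * ξ)) (X⁻¹ * η)))
      Set.univ t := fun t => (hasDerivAt_expAction _ _ t).hasDerivWithinAt
  refine ⟨fun t _ => ?_, fun t _ => ?_⟩
  · rw [show glTransport β X ξ η = _ from funext (glTransport_eq_glFrame X ξ η)]
    exact (hasDerivWithinAt_glFrame X (X⁻¹ * ξ) (hb t)).differentiableWithinAt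
  · refine (covDerivAlong_glGeodesic h hX ξ uniqueDiffWithinAt_univ
      (glTransport_eq_glFrame X ξ η) (hb t)).trans ?_
    simp [glFrame]

theorem glTransport_zero {X : Matrix (Fin n) (Fin n) ℝ} (hX : X ∈ GLPlus n)
    (ξ η : Matrix (Fin n) (Fin n) ℝ) : glTransport β X ξ η 0 = η := by
  rw [glTransport_eq_glFrame, expAction_zero_smul, glFrame_zero,
    Matrix.mul_nonsing_inv_cancel_left _ _ (isUnit_det_of_mem_GLPlus hX)]

theorem glCoframe_zero (X a v : Matrix (Fin n) (Fin n) ℝ) :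
    glCoframe β X a 0 v = X⁻¹ * v := by
  simp [glCoframe]

theorem differentiableWithinAt_glCoframe (X a : Matrix (Fin n) (Fin n) ℝ) {J : Set ℝ}
    {V : ℝ → Matrix (Fin n) (Fin n) ℝ} {t : ℝ} (hV : DifferentiableWithinAt ℝ V J t) :
    DifferentiableWithinAt ℝ (fun s => glCoframe β X a s (V s)) J t :=
  ((hV.hasDerivWithinAt.const_mul X⁻¹).exp_smul_mul_mul_exp_smul (-glLeftGenerator β a)
    (-glRightGenerator β a)).differentiableWithinAt

theorem IsParallelOn.eqOn_glTransport
    (h : HasChristoffelFunctionOn (GLPlus n) nabla (glChristoffel β))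
    {X : Matrix (Fin n) (Fin n) ℝ} (hX : X ∈ GLPlus n) (ξ η : Matrix (Fin n) (Fin n) ℝ)
    {J : Set ℝ} {V : ℝ → Matrix (Fin n) (Fin n) ℝ} (hJ : J.OrdConnected) (h0 : (0 : ℝ) ∈ J)
    (hV : IsParallelOn nabla J (glGeodesic β X ξ) V) (hV0 : V 0 = η) :
    Set.EqOn V (glTransport β X ξ η) J := by
  intro t ht
  -- For `J = {0}` derivatives within `J` are not unique and the frame formula for `covDerivAlong`
  -- is unavailable; the initial value alone decides.
  rcases J.subsingleton_or_nontrivial with hs | hs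
  · rw [hs ht h0, hV0, glTransport_zero hX]
  have hU : UniqueDiffOn ℝ J :=
    uniqueDiffOn_convex hJ.convex (hJ.convex.nontrivial_iff_nonempty_interior.1 hs)
  have hB : ∀ s ∈ J, HasDerivWithinAt (fun s => glCoframe β X (X⁻¹ * ξ) s (V s))
      (glTransportOp β (X⁻¹ * ξ) (glCoframe β X (X⁻¹ * ξ) s (V s))) J s := fun s hs => by
    have hd := (differentiableWithinAt_glCoframe (β := β) X (X⁻¹ * ξ)
      (hV.differentiableOn s hs)).hasDerivWithinAt
    have he := (covDerivAlong_glGeodesic h hX ξ (hU s hs)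
      (fun r => (glFrame_glCoframe hX (X⁻¹ * ξ) (V r) r).symm) hd).symm.trans
      (hV.equation s hs)
    have he' := congrArg (glCoframe β X (X⁻¹ * ξ) s) he
    rw [glCoframe_glFrame hX, sub_eq_iff_eq_add] at he'
    refine hd.congr_deriv (he'.trans ?_)
    simp [glCoframe]
  have hE := eq_expAction hJ h0 _ hB ht
  rw [glTransport_eq_glFrame, ← hV0]
  simp only [glCoframe_zero] at hE
  rw [← hE, glFrame_glCoframe hX]

theorem skewPart_lie_transpose (u : Matrix (Fin n) (Fin n) ℝ) : skewPart ⁅u, uᵀ⁆ = 0 := by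
  simp [skewPart, Ring.lie_def]

theorem lie_transpose_eq (u : Matrix (Fin n) (Fin n) ℝ) :
    ⁅u, uᵀ⁆ = (2 : ℝ) • (skewPart u * u - u * skewPart u) := by
  simp only [skewPart, Ring.lie_def, mul_sub, sub_mul, Matrix.smul_mul, Matrix.mul_smul]
  module

/-- `skewPart` as a linear map. -/
noncomputable def skewPartLinearMap (n : ℕ) :
    Matrix (Fin n) (Fin n) ℝ →ₗ[ℝ] Matrix (Fin n) (Fin n) ℝ where
  toFun := skewPart
  map_add' := skewPart_add
  map_smul' := skewPart_smul

/-- The body velocity of a geodesic satisfies the Euler equation. -/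
theorem IsGeodesicOn.hasDerivWithinAt_bodyVelocity
    (h : HasChristoffelFunctionOn (GLPlus n) nabla (glChristoffel β)) {J : Set ℝ}
    {c : ℝ → Matrix (Fin n) (Fin n) ℝ} (hc : IsGeodesicOn (GLPlus n) nabla J c) {t : ℝ}
    (ht : t ∈ J) :
    HasDerivWithinAt (fun s => (c s)⁻¹ * derivWithin c J s)
      (-(((1 + β) / 2) • ⁅(c t)⁻¹ * derivWithin c J t, ((c t)⁻¹ * derivWithin c J t)ᵀ⁆)) J t := by
  have hu := isUnit_det_of_mem_GLPlus (hc.mapsTo ht)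
  have h1 := (hc.differentiableOn t ht).hasDerivWithinAt.ringInverse
    ((Matrix.isUnit_iff_isUnit_det (c t)).2 hu)
  have h2 := h1.mul (hc.differentiableOn_velocity t ht).hasDerivWithinAt
  have h3 := hc.equation t ht
  rw [covDerivAlong, h.christoffel_eq (hc.mapsTo ht)] at h3
  have h4 := glChristoffel_mul (β := β) hu ((c t)⁻¹ * derivWithin c J t)
    ((c t)⁻¹ * derivWithin c J t)
  rw [Matrix.mul_nonsing_inv_cancel_left _ _ hu] at h4
  have h5 := (eq_neg_of_add_eq_zero_left h3).trans (congrArg Neg.neg h4)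
  have h6 := congrArg (fun y => (c t)⁻¹ * y) h5
  simp only [mul_neg, Matrix.nonsing_inv_mul_cancel_left _ _ hu] at h6
  simp only [Matrix.nonsing_inv_eq_ringInverse] at h6 ⊢
  refine h2.congr_deriv ((congrArg (fun y => _ + y) h6).trans ?_)
  -- The `-u²` from differentiating the inverse cancels the `u²` from the first Christoffel term,
  -- leaving only the bracket.
  have h7 : ∀ i d z : Matrix (Fin n) (Fin n) ℝ, -(i * d * i) * d
      + -(-((1 / 2 : ℝ) • (i * d * (i * d) + i * d * (i * d))) + ((1 + β) / 4) • (z + z))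
      = -(((1 + β) / 2) • z) := fun i d z => by
    rw [neg_mul, mul_assoc (i * d)]
    module
  exact h7 _ _ _

/-- Used with `P = exp(-sK)` and `Q = exp(sK)`: the conjugation of `a` unwinds and `a - K = S`
remains. The zeros match the two-sided equation with vanishing left coefficient. -/
theorem mul_conj_sub_mul {R : Type*} [Ring R] (e c P : R) {Q a K S : R} (hQ : Q * P = 1)
    (hK : Commute K P) (ha : S + K = a) :
    e * (0 * c + c * (P * a * Q) + c * -K) * P = 0 * (e * c * P) + e * c * P * S := by
  have h : P * a * Q * P = P * S + K * P := by
    rw [mul_assoc, hQ, mul_one, ← ha, mul_add, hK.eq]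
  calc e * (0 * c + c * (P * a * Q) + c * -K) * P
      = e * c * (P * a * Q * P - K * P) := by noncomm_ring
    _ = 0 * (e * c * P) + e * c * P * S := by rw [h]; noncomm_ring

theorem IsGeodesicOn.eqOn_glGeodesic
    (h : HasChristoffelFunctionOn (GLPlus n) nabla (glChristoffel β))
    {X ξ : Matrix (Fin n) (Fin n) ℝ} {J : Set ℝ} {c : ℝ → Matrix (Fin n) (Fin n) ℝ}
    (hJ : J.OrdConnected) (h0 : (0 : ℝ) ∈ J) (hc : IsGeodesicOn (GLPlus n) nabla J c)
    (hc0 : c 0 = X) (hc1 : derivWithin c J 0 = ξ) : Set.EqOn c (glGeodesic β X ξ) J := by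
  intro t ht
  set u : ℝ → Matrix (Fin n) (Fin n) ℝ := fun s => (c s)⁻¹ * derivWithin c J s with hu
  set K := glRightGenerator β (X⁻¹ * ξ) with hK
  have hu0 : u 0 = X⁻¹ * ξ := by simp only [hu, hc0, hc1]
  -- The conservation law that turns the quadratic Euler equation into a linear one.
  have hsk : ∀ s ∈ J, skewPart (u s) = skewPart (X⁻¹ * ξ) := fun s hs => by
    rw [← hu0]
    refine hJ.eq_of_hasDerivWithinAt_zero (f := fun s => skewPart (u s)) (fun r hr => ?_) hs h0
    refine ((hc.hasDerivWithinAt_bodyVelocity h hr).linearMap_comp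
      (skewPartLinearMap n)).congr_deriv ?_
    rw [map_neg, map_smul]
    change -(_ • skewPart _) = _
    rw [skewPart_lie_transpose, smul_zero, neg_zero]
  have hu' : ∀ s ∈ J, HasDerivWithinAt u (-K * u s + u s * K) J s := fun s hs => by
    refine (hc.hasDerivWithinAt_bodyVelocity h hs).congr_deriv ?_
    rw [lie_transpose_eq]
    change -(_ • (2 : ℝ) • (skewPart (u s) * u s - u s * skewPart (u s))) = _
    rw [hsk s hs, hK, glRightGenerator, Matrix.mul_smul, neg_mul, Matrix.smul_mul]
    module
  have hut : ∀ s ∈ J, u s = NormedSpace.exp (s • -K) * (X⁻¹ * ξ) * NormedSpace.exp (s • K) :=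
    fun s hs => by
      rw [← hu0]
      exact eq_exp_smul_mul_mul_exp_smul hJ h0 (-K) K hu' hs
  -- The curve `c exp(-sK)` satisfies `f' = f S`. The factor `exp(r • 0)` is trivial and only fits
  -- the two-sided lemma.
  have hd : ∀ s ∈ J, HasDerivWithinAt
      (fun r : ℝ => NormedSpace.exp (r • (0 : Matrix (Fin n) (Fin n) ℝ)) * c r
        * NormedSpace.exp (r • -K))
      (0 * (NormedSpace.exp (s • (0 : Matrix (Fin n) (Fin n) ℝ)) * c s
        * NormedSpace.exp (s • -K))
        + NormedSpace.exp (s • (0 : Matrix (Fin n) (Fin n) ℝ)) * c s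
        * NormedSpace.exp (s • -K) * glLeftGenerator β (X⁻¹ * ξ)) J s := fun s hs => by
    refine ((hc.differentiableOn s hs).hasDerivWithinAt.exp_smul_mul_mul_exp_smul 0
      (-K)).congr_deriv ?_
    have hv : derivWithin c J s = c s * (NormedSpace.exp (s • -K) * (X⁻¹ * ξ)
        * NormedSpace.exp (s • K)) := by
      rw [← hut s hs, hu, Matrix.mul_nonsing_inv_cancel_left _ _
        (isUnit_det_of_mem_GLPlus (hc.mapsTo hs))]
    have hP : Commute K (NormedSpace.exp (s • -K)) :=
      (((Commute.refl K).neg_right).smul_right s).exp_right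
    exact (congrArg (fun y => _ * (0 * c s + y + c s * -K) * _) hv).trans
      (mul_conj_sub_mul _ _ _ (matrix_exp_smul_mul_exp_neg_smul K s) hP
        (glLeftGenerator_add_glRightGenerator _))
  have hE := eq_exp_smul_mul_mul_exp_smul hJ h0 0 (glLeftGenerator β (X⁻¹ * ξ)) hd ht
  simp only [smul_zero, zero_smul, NormedSpace.exp_zero, one_mul, mul_one, hc0] at hE
  have hE' : c t * NormedSpace.exp (t • -K)
      = X * NormedSpace.exp (t • glLeftGenerator β (X⁻¹ * ξ)) := hE
  rw [glGeodesic_eq_glFrame, glFrame, mul_one, ← mul_assoc, ← hE', mul_assoc,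
    matrix_exp_neg_smul_mul_exp_smul, mul_one]

end GeodesicsAndTransport
theorem mainTheorem5 (n : ℕ) (β : ℝ) (hβ : β ≠ 0) :
    (∀ g : Matrix (Fin n) (Fin n) ℝ,
      glForm n β g g = (g * g).trace - (β + 1) * (skewPart g * skewPart g).trace ∧
      glForm n β g g = (symPart g * symPart g).trace
        + β * ((skewPart g)ᵀ * skewPart g).trace ∧
      glForm n β g g = frobSq g + (β - 1) * frobSq (skewPart g)) ∧
    IsPseudoRiemannianMetricOn (GLPlus n) (glMetric n β) ∧
    (∀ nabla, IsLeviCivitaOn (GLPlus n) (glMetric n β) nabla ↔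
      HasChristoffelFunctionOn (GLPlus n) nabla (glChristoffel β)) ∧
    (∀ nabla, IsLeviCivitaOn (GLPlus n) (glMetric n β) nabla →
      ∀ X ∈ GLPlus n, ∀ ξ : Matrix (Fin n) (Fin n) ℝ,
        (IsGeodesicOn (GLPlus n) nabla Set.univ (glGeodesic β X ξ) ∧
          glGeodesic β X ξ 0 = X ∧ deriv (glGeodesic β X ξ) 0 = ξ ∧
          ∀ (J : Set ℝ) (c : ℝ → Matrix (Fin n) (Fin n) ℝ), J.OrdConnected → 0 ∈ J →
            IsGeodesicOn (GLPlus n) nabla J c → c 0 = X → derivWithin c J 0 = ξ →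
              Set.EqOn c (glGeodesic β X ξ) J) ∧
        ∀ η : Matrix (Fin n) (Fin n) ℝ,
          IsParallelOn nabla Set.univ (glGeodesic β X ξ) (glTransport β X ξ η) ∧
          glTransport β X ξ η 0 = η ∧
          ∀ (J : Set ℝ) (V : ℝ → Matrix (Fin n) (Fin n) ℝ), J.OrdConnected → 0 ∈ J →
            IsParallelOn nabla J (glGeodesic β X ξ) V → V 0 = η →
              Set.EqOn V (glTransport β X ξ η) J) := by
  refine ⟨fun g => ⟨glForm_self_trace g, glForm_self_symPart g, glForm_self_frobSq g⟩,
    isPseudoRiemannianMetricOn_glMetric hβ, isLeviCivitaOn_iff_hasChristoffelFunctionOn hβ, ?_⟩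
  intro nabla hn X hX ξ
  have h := (isLeviCivitaOn_iff_hasChristoffelFunctionOn hβ nabla).1 hn
  refine ⟨⟨isGeodesicOn_glGeodesic h hX ξ, glGeodesic_zero ξ, deriv_glGeodesic_zero hX ξ, ?_⟩, ?_⟩
  · intro J c hJ h0 hc hc0 hc1
    exact hc.eqOn_glGeodesic h hJ h0 hc0 hc1
  · intro η
    refine ⟨isParallelOn_glTransport h hX ξ η, glTransport_zero hX ξ η, ?_⟩
    intro J V hJ h0 hV hV0
    exact hV.eqOn_glTransport h hX ξ η hJ h0 hV0
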